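/- Let $d\ge 3$ and $r>0$. A convex polytope in Euclidean space $\mathbb{E}^d$ is a convex body (a compact convex set with nonempty interior) that is the convex hull of finitely many points. For a set $K\subset\mathbb{E}^d$ and a point $z$, the supporting (sight) cone of $K$ from $z$ is $$C(z,K)=\bigcup_{x\in K}\{z+s(x-z): s\ge 0\}.$$ Two sets $A,B\subset\mathbb{E}^d$ are congruent if there are an orthogonal transformation $\varphi\in O(d)$ and a vector $b\in\mathbb{E}^d$ with $\varphi(A)+b=B$. Let $P,Q$ be two convex polytopes contained in the interior of the ball $r\mathbf{B}^d=\{x\in\mathbb{E}^d: |x|\le r\}$. Assume that for every point $z$ on the sphere $rS^{d-1}=\{x\in\mathbb{E}^d:|x|=r\}$ the supporting cones $C(z,P)$ and $C(z,Q)$ are congruent. Then $P=Q$. -/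

import Mathlib

/-- A convex body in `𝔼ᵈ`: a compact convex set with nonempty interior. -/
def IsConvexBody {d : ℕ} (K : Set (EuclideanSpace ℝ (Fin d))) : Prop :=
  Convex ℝ K ∧ IsCompact K ∧ (interior K).Nonempty

/-- A convex polytope in `𝔼ᵈ`: a convex body that is the convex hull of finitely many points. -/
def IsConvexPolytope {d : ℕ} (P : Set (EuclideanSpace ℝ (Fin d))) : Prop :=
  IsConvexBody P ∧ ∃ S : Set (EuclideanSpace ℝ (Fin d)), S.Finite ∧ P = convexHull ℝ S

/-- The supporting (sight) cone `C(z, K) = ⋃_{x ∈ K} {z + s (x - z) : s ≥ 0}`. -/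
def sightCone {d : ℕ} (z : EuclideanSpace ℝ (Fin d)) (K : Set (EuclideanSpace ℝ (Fin d))) :
    Set (EuclideanSpace ℝ (Fin d)) :=
  ⋃ x ∈ K, {y | ∃ s : ℝ, 0 ≤ s ∧ y = z + s • (x - z)}

/-- Two subsets of `𝔼ᵈ` are congruent if `φ(A) + b = B` for some orthogonal transformation `φ`
and some vector `b`. -/
def AreCongruent {d : ℕ} (A B : Set (EuclideanSpace ℝ (Fin d))) : Prop :=
  ∃ (φ : EuclideanSpace ℝ (Fin d) ≃ₗᵢ[ℝ] EuclideanSpace ℝ (Fin d))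
    (b : EuclideanSpace ℝ (Fin d)), (fun x => φ x + b) '' A = B

/-!
A vertex `v` of `P` is a vertex of `Q`, and by symmetry the two polytopes coincide. The reason is
that the angle under which two points are seen from the sphere determines the two points.

Choose a hyperplane touching `P` at `v` only. From every point `y` of the sphere close to a
fixed one in this hyperplane, `v` is seen on an extreme ray of the sight cone, and there is another
extreme ray through a vertex `v'` (`exists_eventually_two_extremeRays`). A congruence of sight cones fixes
their common apex `y` (`AreCongruent.exists_linearIsometry`) and maps extreme rays to extreme rays,
which pass through vertices `w`, `w'` of `Q`. Comparing the squared cosines of the angles gives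
`‖v - y‖² ‖v' - y‖² ⟪w - y, w' - y⟫² = ‖w - y‖² ‖w' - y‖² ⟪v - y, v' - y⟫²`.

Let `y` run along a great circle, parametrised rationally by `t`. Up to the factor `1 + t²` all
inner products in this identity are real polynomials of degree at most two (`eval_innerPoly`). There
are finitely many choices of `v'`, `w`, `w'`, so one of them satisfies the identity of polynomials. The
polynomial of `‖v - y‖²` has degree two and no real root, so it is prime; for a generic circle
it is not proportional to that of another vertex of `P` or `Q` (`not_innerPoly_self_dvd`). Its
multiplicity in the left side is odd, so it must divide the polynomial of `‖w - y‖²` or of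
`‖w' - y‖²`, which means that `v` is `w` or `w'` (`mem_of_angles_eq`).
-/

open scoped RealInnerProductSpace Topology
open Polynomial

/-! ### Quadratic real polynomials -/

/-- If `p` divides the left side to an odd power, it does so on the right, so it cannot divide
only the square there. -/
lemma Prime.dvd_or_dvd_of_mul_sq_eq {p a b c m n : ℝ[X]} (hp : Prime p) (ha : ¬ p ∣ a)
    (hm : m ≠ 0) (hn : n ≠ 0) (h : p * a * m ^ 2 = b * c * n ^ 2) : p ∣ b ∨ p ∣ c := by
  by_contra! hbc
  have hfm : FiniteMultiplicity p m := FiniteMultiplicity.of_prime_left hp hm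
  have hfn : FiniteMultiplicity p n := FiniteMultiplicity.of_prime_left hp hn
  have h1 := congrArg (emultiplicity p) h
  have hpf : FiniteMultiplicity p p := FiniteMultiplicity.of_prime_left hp hp.ne_zero
  rw [emultiplicity_mul hp, emultiplicity_mul hp, emultiplicity_mul hp, emultiplicity_mul hp,
    emultiplicity_pow hp, emultiplicity_pow hp, emultiplicity_eq_zero.2 ha,
    emultiplicity_eq_zero.2 hbc.1, emultiplicity_eq_zero.2 hbc.2, hpf.emultiplicity_self,
    hfm.emultiplicity_eq_multiplicity, hfn.emultiplicity_eq_multiplicity] at h1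
  norm_cast at h1
  omega

lemma prime_of_natDegree_eq_two {p : ℝ[X]} (hp : p.natDegree = 2) (h : ∀ t, p.eval t ≠ 0) :
    Prime p := by
  apply Irreducible.prime
  refine (Polynomial.irreducible_iff_roots_eq_zero_of_degree_le_three (by omega) (by omega)).2 ?_
  have h0 : p ≠ 0 := by rintro rfl; simp at hp
  refine Multiset.eq_zero_of_forall_notMem fun t ht => h t ?_
  exact (Polynomial.mem_roots h0).1 ht

lemma exists_eq_C_mul_of_dvd {p q : ℝ[X]} (hp : p ≠ 0) (hq : q.natDegree ≤ p.natDegree)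
    (h : p ∣ q) : ∃ c : ℝ, q = C c * p := by
  obtain ⟨m, rfl⟩ := h
  by_cases hm : m = 0
  · exact ⟨0, by simp [hm]⟩
  rw [natDegree_mul hp hm] at hq
  exact ⟨m.coeff 0, by rw [mul_comm, ← eq_C_of_natDegree_eq_zero (by omega)]⟩

/-! ### Great circles -/

section
variable {E : Type*} [NormedAddCommGroup E] [InnerProductSpace ℝ E]

/-- The rational parametrisation, with `circlePoint r z u 0 = z`, of the great circle of radius `r`
through `z` in the direction `u`; here `‖z‖ = r`, `‖u‖ = 1` and `z ⟂ u`. -/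
noncomputable def circlePoint (r : ℝ) (z u : E) (t : ℝ) : E :=
  ((1 - t ^ 2) / (1 + t ^ 2)) • z + (2 * t * r / (1 + t ^ 2)) • u

/-- The polynomial whose value at `t` is `(1 + t²) ⟪a - y, b - y⟫`, where `y = circlePoint r z u t`.
On the sphere `⟪a - y, b - y⟫` is an affine function of `y`, so the numerator is only quadratic. -/
noncomputable def innerPoly (r : ℝ) (z u a b : E) : ℝ[X] :=
  C ⟪a + z, b + z⟫ * X ^ 2 + C (-(2 * r * ⟪a + b, u⟫)) * X + C ⟪a - z, b - z⟫

lemma norm_circlePoint {r : ℝ} (hr : 0 ≤ r) {z u : E} (hz : ‖z‖ = r) (hu : ‖u‖ = 1)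
    (hzu : ⟪z, u⟫ = 0) (t : ℝ) : ‖circlePoint r z u t‖ = r := by
  rw [← sq_eq_sq₀ (norm_nonneg _) hr, ← real_inner_self_eq_norm_sq]
  have h : (1 + t ^ 2) ≠ 0 := by positivity
  have hz' : ⟪z, z⟫ = r ^ 2 := by rw [real_inner_self_eq_norm_sq, hz]
  have hu' : ⟪u, u⟫ = 1 := by rw [real_inner_self_eq_norm_sq, hu, one_pow]
  simp only [circlePoint, inner_add_left, inner_add_right, real_inner_smul_left,
    real_inner_smul_right, hz', hu', hzu, real_inner_comm z u]
  field_simp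
  ring

lemma continuous_circlePoint (r : ℝ) (z u : E) : Continuous (circlePoint r z u) := by
  have h : ∀ t : ℝ, (1 + t ^ 2) ≠ 0 := fun t => by positivity
  unfold circlePoint
  fun_prop (disch := exact h _)

lemma circlePoint_zero (r : ℝ) (z u : E) : circlePoint r z u 0 = z := by simp [circlePoint]

lemma eval_innerPoly {r : ℝ} (hr : 0 ≤ r) {z u : E} (hz : ‖z‖ = r) (hu : ‖u‖ = 1)
    (hzu : ⟪z, u⟫ = 0) (a b : E) (t : ℝ) :
    (innerPoly r z u a b).eval t =
      (1 + t ^ 2) * ⟪a - circlePoint r z u t, b - circlePoint r z u t⟫ := by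
  have hn := norm_circlePoint hr hz hu hzu t
  have h : (1 + t ^ 2) ≠ 0 := by positivity
  have e : ∀ x : E, ⟪x, circlePoint r z u t⟫ =
      ((1 - t ^ 2) * ⟪x, z⟫ + 2 * t * r * ⟪x, u⟫) / (1 + t ^ 2) := fun x => by
    simp only [circlePoint, inner_add_right, real_inner_smul_right]
    field_simp
  rw [inner_sub_left, inner_sub_right, inner_sub_right, real_inner_self_eq_norm_sq, hn,
    real_inner_comm b (circlePoint r z u t), e, e]
  simp only [innerPoly, eval_add, eval_mul, eval_C, eval_pow, eval_X, inner_add_left,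
    inner_add_right, inner_sub_left, inner_sub_right, real_inner_self_eq_norm_sq, hz,
    real_inner_comm b z]
  field_simp
  ring

lemma inner_add_inner_pos {r : ℝ} {z a b : E} (hz : ‖z‖ = r) (ha : ‖a‖ < r) (hb : ‖b‖ < r) :
    0 < ⟪a + z, b + z⟫ + ⟪a - z, b - z⟫ := by
  have h := neg_le_of_abs_le (abs_real_inner_le_norm a b)
  have := mul_lt_mul'' ha hb (norm_nonneg _) (norm_nonneg _)
  simp only [inner_add_left, inner_add_right, inner_sub_left, inner_sub_right,
    real_inner_self_eq_norm_sq, hz]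
  nlinarith

lemma coeff_two_innerPoly (r : ℝ) (z u a b : E) :
    (innerPoly r z u a b).coeff 2 = ⟪a + z, b + z⟫ := by
  simp [innerPoly]

lemma coeff_zero_innerPoly (r : ℝ) (z u a b : E) :
    (innerPoly r z u a b).coeff 0 = ⟪a - z, b - z⟫ := by
  simp [innerPoly]

/-- The sum of the constant and leading coefficients is `2 (⟪a, b⟫ + r²)`, which is positive. -/
lemma innerPoly_ne_zero {r : ℝ} {z u a b : E} (hz : ‖z‖ = r) (ha : ‖a‖ < r) (hb : ‖b‖ < r) :
    innerPoly r z u a b ≠ 0 := by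
  intro h
  have h2 := congrArg (fun p => p.coeff 2 + p.coeff 0) h
  simp only [coeff_two_innerPoly, coeff_zero_innerPoly, coeff_zero, add_zero] at h2
  linarith [inner_add_inner_pos hz ha hb]

lemma natDegree_innerPoly_self {r : ℝ} {z u a : E} (hz : ‖z‖ = r) (ha : ‖a‖ < r) :
    (innerPoly r z u a a).natDegree = 2 := by
  apply natDegree_quadratic
  rw [Ne, inner_self_eq_zero, add_eq_zero_iff_eq_neg]
  rintro rfl
  simp [hz] at ha

/-- A point `a` inside the sphere keeps a positive distance from the circle, so the quadratic
polynomial of `‖a - y‖²` has no real root. -/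
lemma prime_innerPoly_self {r : ℝ} {z u a : E} (hz : ‖z‖ = r) (hu : ‖u‖ = 1)
    (hzu : ⟪z, u⟫ = 0) (ha : ‖a‖ < r) : Prime (innerPoly r z u a a) := by
  have hr : 0 ≤ r := hz ▸ norm_nonneg z
  refine prime_of_natDegree_eq_two (natDegree_innerPoly_self hz ha) fun t => ?_
  rw [eval_innerPoly hr hz hu hzu]
  have h : (1 + t ^ 2) ≠ 0 := by positivity
  refine mul_ne_zero h ?_
  rw [Ne, inner_self_eq_zero, sub_eq_zero]
  rintro rfl
  exact ha.ne (norm_circlePoint hr hz hu hzu t)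

/-- The normal vector of the hyperplane through the origin outside of which `z` has the following
property: the polynomials of `‖a - y‖²` and `‖b - y‖²` along every great circle through `z`
are not proportional. -/
noncomputable def separator (r : ℝ) (a b : E) : E := (r ^ 2 + ‖b‖ ^ 2) • a - (r ^ 2 + ‖a‖ ^ 2) • b

/-- The function `x ↦ x / (r² + x²)` is injective on `[0, r)`. -/
lemma separator_ne_zero {r : ℝ} {a b : E} (ha : ‖a‖ < r) (hb : ‖b‖ < r) (hab : a ≠ b) :
    separator r a b ≠ 0 := by
  intro h
  have hr : 0 < r := (norm_nonneg a).trans_lt ha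
  rw [separator, sub_eq_zero] at h
  have h1 := congrArg norm h
  rw [norm_smul, norm_smul, Real.norm_of_nonneg (by positivity),
    Real.norm_of_nonneg (by positivity)] at h1
  have h2 : (r ^ 2 - ‖a‖ * ‖b‖) * (‖a‖ - ‖b‖) = 0 := by linear_combination h1
  have := mul_lt_mul'' ha hb (norm_nonneg _) (norm_nonneg _)
  have h3 : ‖a‖ = ‖b‖ := by
    rcases mul_eq_zero.1 h2 with h | h <;> nlinarith
  rw [h3] at h
  exact hab (smul_right_injective E (by positivity : r ^ 2 + ‖b‖ ^ 2 ≠ 0) h)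

lemma not_innerPoly_self_dvd {r : ℝ} {z u a b : E} (hz : ‖z‖ = r) (ha : ‖a‖ < r) (hb : ‖b‖ < r)
    (hab : ⟪separator r a b, z⟫ ≠ 0) : ¬ innerPoly r z u a a ∣ innerPoly r z u b b := by
  intro h
  obtain ⟨c, hc⟩ := exists_eq_C_mul_of_dvd (innerPoly_ne_zero hz ha ha)
    (by rw [natDegree_innerPoly_self hz ha, natDegree_innerPoly_self hz hb]) h
  have h2 := congrArg (fun p => p.coeff 2) hc
  have h0 := congrArg (fun p => p.coeff 0) hc
  simp only [coeff_C_mul, coeff_two_innerPoly, coeff_zero_innerPoly] at h0 h2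
  apply hab
  have h3 : ⟪b + z, b + z⟫ * ⟪a - z, a - z⟫ = ⟪b - z, b - z⟫ * ⟪a + z, a + z⟫ := by
    rw [h0, h2]; ring
  have hr : 0 < r := (norm_nonneg a).trans_lt ha
  simp only [inner_add_left, inner_add_right, inner_sub_left, inner_sub_right,
    real_inner_self_eq_norm_sq, hz, real_inner_comm a z, real_inner_comm b z] at h3
  simp only [separator, inner_sub_left, real_inner_smul_left]
  linear_combination (-1/4) * h3

/-- Suppose that, for all points `y` of the sphere near `z`, the lines from `y` to `v` and to some
`v' ∈ S` make the same angle (up to supplement) as the lines from `y` to two points of `T`.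
If `z` is generic, then `v ∈ T`: along a great circle one choice of `v', w, w'` works
identically, and the prime polynomial of `‖v - y‖²` occurs to an odd power on the left. -/
lemma mem_of_angles_eq {r : ℝ} {z u v : E} {S T : Set E} (hS : S.Finite) (hT : T.Finite)
    (hz : ‖z‖ = r) (hu : ‖u‖ = 1) (hzu : ⟪z, u⟫ = 0) (hv : ‖v‖ < r)
    (hSr : ∀ s ∈ S, ‖s‖ < r) (hTr : ∀ s ∈ T, ‖s‖ < r)
    (hsS : ∀ s ∈ S, ⟪separator r v s, z⟫ ≠ 0) (hsT : ∀ s ∈ T, v ≠ s → ⟪separator r v s, z⟫ ≠ 0)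
    (h : ∀ᶠ y in 𝓝 z, ‖y‖ = r → ∃ v' ∈ S, ∃ w ∈ T, ∃ w' ∈ T,
      ⟪v - y, v - y⟫ * ⟪v' - y, v' - y⟫ * ⟪w - y, w' - y⟫ ^ 2 =
        ⟪w - y, w - y⟫ * ⟪w' - y, w' - y⟫ * ⟪v - y, v' - y⟫ ^ 2) : v ∈ T := by
  have hr : 0 ≤ r := hz ▸ norm_nonneg z
  let B := innerPoly r z u
  let G : E × E × E → ℝ[X] := fun p =>
    B v v * B p.1 p.1 * B p.2.1 p.2.2 ^ 2 - B p.2.1 p.2.1 * B p.2.2 p.2.2 * B v p.1 ^ 2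
  have hfin := hS.prod (hT.prod hT)
  -- a product over all choices vanishes at infinitely many `t`, so one factor is zero
  have hG : ∏ p ∈ hfin.toFinset, G p = 0 := by
    have hc : Filter.Tendsto (circlePoint r z u) (𝓝 0) (𝓝 z) := by
      simpa [circlePoint_zero] using (continuous_circlePoint r z u).tendsto 0
    have h' := hc.eventually h
    refine eq_zero_of_infinite_isRoot _ ((infinite_of_mem_nhds (0 : ℝ) h').mono ?_)
    intro t ht
    obtain ⟨v', hv', w, hw, w', hw', e⟩ := ht (norm_circlePoint hr hz hu hzu t)
    change eval t _ = 0
    rw [eval_prod]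
    refine Finset.prod_eq_zero (i := (v', w, w')) (by simp [hv', hw, hw']) ?_
    simp only [G, B, eval_sub, eval_mul, eval_pow, eval_innerPoly hr hz hu hzu]
    linear_combination (1 + t ^ 2) ^ 4 * e
  obtain ⟨⟨v', w, w'⟩, hp, h0⟩ := Finset.prod_eq_zero_iff.1 hG
  simp only [Set.Finite.mem_toFinset, Set.mem_prod] at hp
  obtain ⟨hv', hw, hw'⟩ := hp
  have key := (prime_innerPoly_self hz hu hzu hv).dvd_or_dvd_of_mul_sq_eq
    (not_innerPoly_self_dvd hz hv (hSr _ hv') (hsS _ hv'))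
    (innerPoly_ne_zero hz (hTr _ hw) (hTr _ hw')) (innerPoly_ne_zero hz hv (hSr _ hv'))
    (sub_eq_zero.1 h0)
  by_contra hvT
  have hne : ∀ s ∈ T, v ≠ s := by rintro s hs rfl; exact hvT hs
  rcases key with k | k
  · exact not_innerPoly_self_dvd hz hv (hTr _ hw) (hsT _ hw (hne _ hw)) k
  · exact not_innerPoly_self_dvd hz hv (hTr _ hw') (hsT _ hw' (hne _ hw')) k

/-! ### Cones of directions and their extreme rays -/

/-- The convex cone generated by `K - z`, that is, the sight cone of `K` from `z` moved to have its
apex at the origin. -/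
def viewCone (z : E) (K : Set E) : Set E := {x | ∃ p ∈ K, ∃ s : ℝ, 0 ≤ s ∧ x = s • (p - z)}

/-- The vector `x` is nonzero and spans an extreme ray of the cone `C`: whenever `x` is a sum of two
elements of `C`, the first (hence by symmetry each) is a nonnegative multiple of `x`. -/
def SpansExtremeRay (C : Set E) (x : E) : Prop :=
  x ∈ C ∧ x ≠ 0 ∧ ∀ a ∈ C, ∀ b ∈ C, a + b = x → ∃ c : ℝ, 0 ≤ c ∧ a = c • x

lemma sub_mem_viewCone {z p : E} {K : Set E} (hp : p ∈ K) : p - z ∈ viewCone z K :=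
  ⟨p, hp, 1, zero_le_one, (one_smul _ _).symm⟩

lemma smul_mem_viewCone {z x : E} {K : Set E} {c : ℝ} (hc : 0 ≤ c) (hx : x ∈ viewCone z K) :
    c • x ∈ viewCone z K := by
  obtain ⟨p, hp, s, hs, rfl⟩ := hx
  exact ⟨p, hp, c * s, by positivity, by rw [mul_smul]⟩

lemma add_mem_viewCone {z x y : E} {K : Set E} (hK : Convex ℝ K) (hx : x ∈ viewCone z K)
    (hy : y ∈ viewCone z K) : x + y ∈ viewCone z K := by
  obtain ⟨p, hp, s, hs, rfl⟩ := hx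
  obtain ⟨q, hq, t, ht, rfl⟩ := hy
  rcases hs.eq_or_lt with rfl | hs'
  · exact ⟨q, hq, t, ht, by simp⟩
  have hst : 0 < s + t := by positivity
  refine ⟨(s / (s + t)) • p + (t / (s + t)) • q,
    hK hp hq (by positivity) (by positivity) (by field_simp), s + t, hst.le, ?_⟩
  rw [smul_sub (s + t), smul_add, smul_smul, smul_smul, mul_div_cancel₀ _ hst.ne',
    mul_div_cancel₀ _ hst.ne']
  module

lemma pos_of_mem_viewCone {z x : E} {S : Set E} {k : E →ₗ[ℝ] ℝ}
    (hk : ∀ s ∈ S, 0 < k (s - z)) (hx : x ∈ viewCone z (convexHull ℝ S)) (hx0 : x ≠ 0) :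
    0 < k x := by
  obtain ⟨p, hp, s, hs, rfl⟩ := hx
  have hc : Convex ℝ {p | k z < k p} := (convex_Ioi (k z)).linear_preimage k
  have := convexHull_min (fun s hs => by simpa using hk s hs) hc hp
  have hs' : s ≠ 0 := by rintro rfl; simp at hx0
  simp only [Set.mem_ofPred_eq] at this
  rw [map_smul, map_sub, smul_eq_mul]
  exact mul_pos (hs.lt_of_ne' hs') (by linarith)

/-- Each extreme ray of the cone over a convex hull passes through one of the generators: the points
of the hull on the ray form a face, and the complement of a face is convex. -/
lemma SpansExtremeRay.exists_generator {z x : E} {S : Set E} (hz : z ∉ convexHull ℝ S)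
    (hx : SpansExtremeRay (viewCone z (convexHull ℝ S)) x) : ∃ s ∈ S, ∃ c : ℝ, x = c • (s - z) := by
  by_contra! hcon
  let F : Set E := {q | q ∈ convexHull ℝ S ∧ ∃ c : ℝ, 0 < c ∧ q - z = c • x}
  have hF : IsExtreme ℝ (convexHull ℝ S) F := by
    refine ⟨fun q hq => hq.1, ?_⟩
    rintro a ha b hb q ⟨-, c, hc, hq⟩ ⟨α, β, hα, hβ, hαβ, rfl⟩
    have e : (α / c) • (a - z) + (β / c) • (b - z) = x := by
      have : c • ((α / c) • (a - z) + (β / c) • (b - z)) = c • x := by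
        rw [← hq, smul_add, smul_smul, smul_smul, mul_div_cancel₀ _ hc.ne',
          mul_div_cancel₀ _ hc.ne']
        nth_rw 3 [← one_smul ℝ z]
        rw [← hαβ]
        module
      exact smul_right_injective E hc.ne' this
    obtain ⟨c', hc', h'⟩ := hx.2.2 _ (smul_mem_viewCone (by positivity) (sub_mem_viewCone ha)) _
      (smul_mem_viewCone (by positivity) (sub_mem_viewCone hb)) e
    have e2 : a - z = (c / α * c') • x := by
      rw [mul_smul, ← h', smul_smul]
      have : c / α * (α / c) = 1 := by field_simp
      rw [this, one_smul]
    refine ⟨ha, c / α * c', ?_, e2⟩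
    refine lt_of_le_of_ne (by positivity) fun h0 => ?_
    rw [← h0, zero_smul, sub_eq_zero] at e2
    exact hz (e2 ▸ ha)
  have hsub : convexHull ℝ S ⊆ convexHull ℝ S \ F := by
    refine convexHull_min (fun s hs => ⟨subset_convexHull ℝ S hs, ?_⟩)
      (hF.convex_sdiff (convex_convexHull ℝ S))
    rintro ⟨-, c, hc, h⟩
    exact hcon s hs c⁻¹ (by rw [h, smul_smul, inv_mul_cancel₀ hc.ne', one_smul])
  obtain ⟨⟨p, hp, s, hs, hxp⟩, hx0, -⟩ := hx
  have hs' : s ≠ 0 := by rintro rfl; simp [hxp] at hx0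
  refine (hsub hp).2 ⟨hp, s⁻¹, by positivity, ?_⟩
  rw [hxp, smul_smul, inv_mul_cancel₀ hs', one_smul]

/-- A ray on which a supporting functional `g` attains its maximum `0`, and which is the only such
ray through a generator, is extreme. -/
lemma spansExtremeRay_of_exposed {z v : E} {S : Set E} {g : E →ₗ[ℝ] ℝ} (hv : v ∈ S) (hvz : v ≠ z)
    (hgv : g (v - z) = 0) (hg : ∀ s ∈ S \ {v}, g (s - z) < 0) :
    SpansExtremeRay (viewCone z (convexHull ℝ S)) (v - z) := by
  have hle : ∀ x ∈ viewCone z (convexHull ℝ S), g x ≤ 0 := by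
    rintro _ ⟨p, hp, s, hs, rfl⟩
    have hc : Convex ℝ {p | g p ≤ g z} := (convex_Iic (g z)).linear_preimage g
    have := convexHull_min (s := S) (fun s hs => by
      by_cases h : s = v
      · subst h; simpa [sub_eq_zero] using hgv.le
      · simpa using (hg s ⟨hs, h⟩).le) hc hp
    simp only [Set.mem_ofPred_eq] at this
    rw [map_smul, map_sub, smul_eq_mul]
    exact mul_nonpos_of_nonneg_of_nonpos hs (by linarith)
  refine ⟨sub_mem_viewCone (subset_convexHull ℝ S hv), sub_ne_zero.2 hvz, ?_⟩
  intro a ha b hb hab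
  have h0 : g a = 0 := by
    have := congrArg g hab
    rw [map_add, hgv] at this
    linarith [hle a ha, hle b hb]
  obtain ⟨p, hp, s, hs, rfl⟩ := ha
  rcases hs.eq_or_lt with rfl | hs'
  · exact ⟨0, le_rfl, by simp⟩
  refine ⟨s, hs, ?_⟩
  rw [map_smul, smul_eq_mul, mul_eq_zero, or_iff_right hs'.ne'] at h0
  -- write `p` as a convex combination of `v` and a point of the hull of the other generators
  suffices p = v by rw [this]
  rcases (S \ {v}).eq_empty_or_nonempty with hS | hS
  · have : S ⊆ {v} := Set.sdiff_eq_empty.1 hS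
    simpa using convexHull_mono this hp
  rw [← Set.insert_sdiff_self_of_mem hv, convexHull_insert hS, mem_convexJoin] at hp
  obtain ⟨v', rfl, q, hq, α, β, hα, hβ, hαβ, rfl⟩ := hp
  have hc : Convex ℝ {p | g p < g z} := (convex_Iio (g z)).linear_preimage g
  have hqz : g q < g z := convexHull_min (fun s hs => by simpa using hg s hs) hc hq
  have hβ0 : β = 0 := by
    rw [map_sub, sub_eq_zero] at hgv
    rw [map_sub, map_add, map_smul, map_smul, hgv, smul_eq_mul, smul_eq_mul,
      (by linarith : α = 1 - β)] at h0
    have : β * (g q - g z) = 0 := by linarith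
    exact (mul_eq_zero.1 this).resolve_right (by linarith)
  rw [hβ0, (by linarith : α = 1), one_smul, zero_smul, add_zero]

/-- The cone has an extreme ray other than that of `v`. Cut the cone with the affine hyperplane
`k = k (v - z)`; the generator whose ray meets this section farthest from `v - z` is extreme, by
strict convexity of the norm. -/
lemma exists_second_extremeRay {z v : E} {S : Set E} (hS : S.Finite) {g k : E →ₗ[ℝ] ℝ}
    (hv : v ∈ S) (hne : (S \ {v}).Nonempty) (hk : ∀ s ∈ S, 0 < k (s - z))
    (hgv : g (v - z) = 0) (hg : ∀ s ∈ S \ {v}, g (s - z) < 0) :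
    ∃ v' ∈ S \ {v}, SpansExtremeRay (viewCone z (convexHull ℝ S)) (v' - z) := by
  have hkv := hk v hv
  -- `L x / k x` is, up to a factor, the displacement from `v - z` to the trace of the ray of `x`
  -- in the section
  let L : E →ₗ[ℝ] E := LinearMap.id - (k.smulRight ((k (v - z))⁻¹ • (v - z)))
  have hL : ∀ x, L x = x - (k x / k (v - z)) • (v - z) := fun x => by
    simp [L, smul_smul, div_eq_mul_inv]
  obtain ⟨v', hv', hmax⟩ := (hS.sdiff (t := {v})).exists_maximalFor
    (fun s => ‖L (s - z)‖ / k (s - z)) _ hne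
  have hk' := hk v' hv'.1
  have hLv' : L (v' - z) ≠ 0 := by
    intro h0
    rw [hL, sub_eq_zero] at h0
    have := hg v' hv'
    rw [h0, map_smul, hgv, smul_zero] at this
    exact this.false
  set R := ‖L (v' - z)‖ / k (v' - z) with hR
  have hR0 : 0 < R := by positivity
  have hbound : ∀ x ∈ viewCone z (convexHull ℝ S), ‖L x‖ ≤ R * k x := by
    rintro _ ⟨p, hp, s, hs, rfl⟩
    have hc : Convex ℝ {p | ‖L (p - z)‖ - R * k (p - z) ≤ 0} := by
      intro a ha b hb α β hα hβ hαβ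
      simp only [Set.mem_ofPred_eq] at ha hb ⊢
      have e : α • a + β • b - z = α • (a - z) + β • (b - z) := by
        nth_rw 1 [← one_smul ℝ z]
        rw [← hαβ]
        module
      rw [e]
      have h1 := norm_add_le (α • L (a - z)) (β • L (b - z))
      rw [norm_smul, norm_smul, Real.norm_of_nonneg hα, Real.norm_of_nonneg hβ] at h1
      simp only [map_add, map_smul, smul_eq_mul] at h1 ⊢
      nlinarith [mul_nonneg hα (sub_nonneg.2 ha), mul_nonneg hβ (sub_nonneg.2 hb)]
    have h1 := convexHull_min (s := S) (fun s hs => by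
      by_cases h : s = v
      · subst h
        simp only [Set.mem_ofPred_eq, hL, div_self hkv.ne', one_smul, sub_self, norm_zero]
        nlinarith
      · have h2 : ‖L (s - z)‖ / k (s - z) ≤ R :=
          (le_total _ _).elim id (hmax (show s ∈ S \ {v} from ⟨hs, h⟩))
        simp only [Set.mem_ofPred_eq]
        linarith [(div_le_iff₀ (hk s hs)).1 h2]) hc hp
    simp only [Set.mem_ofPred_eq] at h1
    rw [map_smul, map_smul, norm_smul, Real.norm_of_nonneg hs, smul_eq_mul]
    nlinarith
  refine ⟨v', hv', sub_mem_viewCone (subset_convexHull ℝ S hv'.1), ?_, ?_⟩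
  · intro h0
    simp [h0] at hk'
  intro a ha b hb hab
  have hka : ‖L a‖ ≤ R * k a := hbound a ha
  have hkb : ‖L b‖ ≤ R * k b := hbound b hb
  have hsum : ‖L (a + b)‖ = R * k (a + b) := by
    rw [hab, hR, div_mul_cancel₀ _ hk'.ne']
  have htri := norm_add_le (L a) (L b)
  rw [map_add, map_add] at hsum
  -- equality holds in the triangle inequality
  have hray : SameRay ℝ (L a) (L b) := sameRay_iff_norm_add.2 (by linarith)
  have hea : ‖L a‖ = R * k a := by linarith
  have hray' : SameRay ℝ (L a) (L (v' - z)) := by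
    rw [← hab, map_add]
    exact (SameRay.refl _).add_right hray
  have h1 := hray'.norm_smul_eq
  have h2 : ‖L (v' - z)‖ = R * k (v' - z) := by rw [hR, div_mul_cancel₀ _ hk'.ne']
  rw [hea, h2, mul_smul, mul_smul] at h1
  have h3 := smul_right_injective E hR0.ne' h1
  have hka0 : 0 ≤ k a := by
    have := (norm_nonneg _).trans hka
    exact nonneg_of_mul_nonneg_right this hR0
  refine ⟨k a / k (v' - z), by positivity, ?_⟩
  simp only [hL] at h3
  have h4 : k a • (v' - z) = k (v' - z) • a := by
    have e1 : k a • (k (v' - z) / k (v - z)) • (v - z) =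
        k (v' - z) • (k a / k (v - z)) • (v - z) := by
      rw [smul_smul, smul_smul]; congr 1; ring
    rw [smul_sub (k a), smul_sub (k (v' - z)) a, e1] at h3
    exact sub_left_injective h3
  rw [div_eq_inv_mul, mul_smul, h4, smul_smul, inv_mul_cancel₀ hk'.ne', one_smul]

lemma exists_norm_add_smul_eq {r : ℝ} {v u : E} (hv : ‖v‖ < r) (hu : u ≠ 0) :
    ∃ t : ℝ, ‖v + t • u‖ = r := by
  have hc : Continuous fun t : ℝ => ‖v + t • u‖ := by fun_prop
  have hu' : 0 < ‖u‖ := norm_pos_iff.2 hu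
  have hr : 0 < r := (norm_nonneg v).trans_lt hv
  have h2 : r ≤ ‖v + (2 * r / ‖u‖) • u‖ := by
    have h := norm_sub_le (v + (2 * r / ‖u‖) • u) v
    rw [add_sub_cancel_left, norm_smul, Real.norm_of_nonneg (by positivity),
      div_mul_cancel₀ _ hu'.ne'] at h
    linarith
  obtain ⟨t, -, ht⟩ := intermediate_value_Icc (by positivity : 0 ≤ 2 * r / ‖u‖) hc.continuousOn
    ⟨by simpa using hv.le, h2⟩
  exact ⟨t, ht⟩

lemma norm_lt_of_mem_convexHull {r : ℝ} {S : Set E} (hS : ∀ s ∈ S, ‖s‖ < r) {p : E}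
    (hp : p ∈ convexHull ℝ S) : ‖p‖ < r := by
  simpa using convexHull_min (fun s hs => by simpa using hS s hs) (convex_ball (0 : E) r) hp

lemma neg_inner_sub_pos {r : ℝ} {z s : E} (hz : ‖z‖ = r) (hs : ‖s‖ < r) :
    0 < (-innerₛₗ ℝ z) (s - z) := by
  have h1 := real_inner_le_norm z s
  have h0 := norm_nonneg s
  have h3 : -(innerₛₗ ℝ z) (s - z) = r ^ 2 - ⟪z, s⟫ := by
    simp [inner_sub_right, hz]
  rw [LinearMap.neg_apply, h3]
  rw [hz] at h1
  nlinarith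

/-- A vertex `v` of a polytope in the ball is seen as an extreme ray, together with another vertex,
from all points of a nonempty open part of the sphere: those close to a point `z₀` in a hyperplane
that touches the polytope at `v` only. -/
lemma exists_eventually_two_extremeRays [FiniteDimensional ℝ E] (hd : 2 ≤ Module.finrank ℝ E)
    {r : ℝ}
    {v : E} {S : Set E} (hS : S.Finite) (hSr : ∀ s ∈ S, ‖s‖ < r) (hv : v ∈ S)
    (hvS : v ∉ convexHull ℝ (S \ {v})) (hne : (S \ {v}).Nonempty) :
    ∃ z₀ : E, ‖z₀‖ = r ∧ ∀ᶠ z in 𝓝 z₀, ‖z‖ = r →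
      SpansExtremeRay (viewCone z (convexHull ℝ S)) (v - z) ∧
      ∃ v' ∈ S \ {v}, SpansExtremeRay (viewCone z (convexHull ℝ S)) (v' - z) := by
  obtain ⟨f, c, hfc, hcv⟩ := geometric_hahn_banach_closed_point
    (convex_convexHull ℝ (S \ {v})) (hS.sdiff.isClosed_convexHull ℝ) hvS
  have hf : ∀ s ∈ S \ {v}, f s < f v := fun s hs => (hfc s (subset_convexHull ℝ _ hs)).trans hcv
  obtain ⟨u, hu, hu0⟩ := Submodule.exists_mem_ne_zero_of_ne_bot
    (LinearMap.ker_ne_bot_of_finrank_lt (f := (f : E →ₗ[ℝ] ℝ)) (by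
      rw [Module.finrank_self]; omega))
  replace hu : f u = 0 := hu
  obtain ⟨t, ht⟩ := exists_norm_add_smul_eq (hSr v hv) hu0
  set z₀ := v + t • u with hz₀
  have hfz : f z₀ = f v := by simp [hz₀, hu]
  have hvz₀ : v - z₀ ≠ 0 := by
    rw [sub_ne_zero]
    intro h
    have := hSr v hv
    rw [h, ht] at this
    exact this.false
  refine ⟨z₀, ht, ?_⟩
  -- `f` tilted so as to vanish at `v - z`
  let g : E → E →ₗ[ℝ] ℝ := fun z =>
    ⟪v - z₀, v - z⟫ • (f : E →ₗ[ℝ] ℝ) - f (v - z) • (innerₛₗ ℝ (v - z₀))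
  have hg : ∀ z x, g z x = ⟪v - z₀, v - z⟫ * f x - f (v - z) * ⟪v - z₀, x⟫ := fun z x => by
    simp only [g, LinearMap.sub_apply, LinearMap.smul_apply, smul_eq_mul, innerₛₗ_apply_apply,
      ContinuousLinearMap.coe_coe]
  have hev : ∀ᶠ z in 𝓝 z₀, ∀ s ∈ S \ {v}, g z (s - z) < 0 := by
    rw [Filter.eventually_all_finite hS.sdiff]
    intro s hs
    have hc : Continuous fun z => g z (s - z) := by
      simp only [hg]
      fun_prop
    refine hc.continuousAt.eventually_lt continuousAt_const ?_
    have hpos := real_inner_self_pos.2 hvz₀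
    simp only [hg, map_sub, hfz, sub_self, zero_mul, sub_zero]
    exact mul_neg_of_pos_of_neg hpos (by linarith [hf s hs])
  filter_upwards [hev] with z hz hzr
  have hgv : g z (v - z) = 0 := by rw [hg]; ring
  have hvz : v ≠ z := by rintro rfl; exact (hSr v hv).ne hzr
  refine ⟨spansExtremeRay_of_exposed hv hvz hgv hz,
    exists_second_extremeRay hS (k := -innerₛₗ ℝ z) hv hne ?_ hgv hz⟩
  exact fun s hs => neg_inner_sub_pos hzr (hSr s hs)

/-- Finitely many hyperplanes through the origin cover no nonempty open part of the sphere. -/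
lemma exists_generic_point [FiniteDimensional ℝ E] {r : ℝ} (hr : 0 < r) {N : Set E}
    (hN : N.Finite) (hN0 : ∀ n ∈ N, n ≠ 0)
    {z₀ : E} (hz₀ : ‖z₀‖ = r) {p : E → Prop} (hp : ∀ᶠ z in 𝓝 z₀, p z) :
    ∃ z, ‖z‖ = r ∧ (∀ n ∈ N, ⟪n, z⟫ ≠ 0) ∧ ∀ᶠ y in 𝓝 z, p y := by
  have hz0 : z₀ ≠ 0 := by rintro rfl; simp at hz₀; exact hr.ne hz₀
  have hdense : ∀ n ∈ N, Dense {x : E | ⟪n, x⟫ ≠ 0} := by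
    intro n hn
    have h : Dense ((LinearMap.ker (innerₛₗ ℝ n) : Set E)ᶜ) := by
      rw [← interior_eq_empty_iff_dense_compl, ← Set.not_nonempty_iff_eq_empty]
      intro hne
      have htop := Submodule.eq_top_of_nonempty_interior' _ hne
      have hn' : n ∈ LinearMap.ker (innerₛₗ ℝ n) := htop ▸ Submodule.mem_top
      exact hN0 n hn (inner_self_eq_zero.1 hn')
    exact h
  have hD : Dense (⋂ n ∈ N, {x : E | ⟪n, x⟫ ≠ 0}) := by
    have := FiniteDimensional.complete ℝ E
    refine dense_biInter_of_isOpen (fun n _ => ?_) hN.countable hdense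
    exact isOpen_ne_fun (by fun_prop) continuous_const
  have hc : Filter.Tendsto (fun x : E => (r / ‖x‖) • x) (𝓝 z₀) (𝓝 z₀) := by
    have : ContinuousAt (fun x : E => (r / ‖x‖) • x) z₀ := by
      have : ‖z₀‖ ≠ 0 := norm_ne_zero_iff.2 hz0
      fun_prop (disch := assumption)
    simpa [ContinuousAt, hz₀, div_self hr.ne'] using this
  have hev := (hc.eventually hp.eventually_nhds).and (isOpen_ne.eventually_mem hz0)
  obtain ⟨x, hx, hxp, hx0⟩ := hD.inter_nhds_nonempty hev
  have hx0' : ‖x‖ ≠ 0 := norm_ne_zero_iff.2 hx0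
  refine ⟨(r / ‖x‖) • x, ?_, ?_, hxp⟩
  · rw [norm_smul, Real.norm_of_nonneg (by positivity), div_mul_cancel₀ _ hx0']
  · intro n hn
    rw [inner_smul_right]
    exact mul_ne_zero (by positivity) (by simpa using Set.mem_iInter₂.1 hx n hn)

/-- If the cones over two polytopes are isometric from all points of the sphere, each vertex of the
first is a vertex of the second. -/
lemma mem_of_isometric_viewCones [FiniteDimensional ℝ E] (hd : 2 ≤ Module.finrank ℝ E)
    {r : ℝ}
    {v : E} {S T : Set E} (hS : S.Finite) (hT : T.Finite) (hSr : ∀ s ∈ S, ‖s‖ < r)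
    (hTr : ∀ s ∈ T, ‖s‖ < r) (hv : v ∈ S)
    (hvS : v ∉ convexHull ℝ (S \ {v})) (hne : (S \ {v}).Nonempty)
    (h : ∀ z : E, ‖z‖ = r → ∃ φ : E ≃ₗᵢ[ℝ] E, ∀ x,
      φ x ∈ viewCone z (convexHull ℝ T) ↔ x ∈ viewCone z (convexHull ℝ S)) : v ∈ T := by
  obtain ⟨z₀, hz₀, hev⟩ := exists_eventually_two_extremeRays hd hS hSr hv hvS hne
  have hr : 0 < r := (norm_nonneg v).trans_lt (hSr v hv)
  obtain ⟨z, hz, hzN, hzev⟩ := exists_generic_point hr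
    (N := separator r v '' ((S ∪ T) \ {v})) ((hS.union hT).sdiff.image _) (by
      rintro _ ⟨s, ⟨hs, hsv⟩, rfl⟩
      exact separator_ne_zero (hSr v hv) (hs.elim (hSr s) (hTr s)) (Ne.symm hsv)) hz₀ hev
  obtain ⟨u, hu, hzu⟩ : ∃ u : E, ‖u‖ = 1 ∧ ⟪z, u⟫ = 0 := by
    obtain ⟨u, hu, hu0⟩ := Submodule.exists_mem_ne_zero_of_ne_bot
      (LinearMap.ker_ne_bot_of_finrank_lt (f := innerₛₗ ℝ z) (by
        rw [Module.finrank_self]; omega))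
    replace hu : ⟪z, u⟫ = 0 := hu
    exact ⟨‖u‖⁻¹ • u, by
      rw [norm_smul, norm_inv, norm_norm, inv_mul_cancel₀ (norm_ne_zero_iff.2 hu0)],
      by rw [inner_smul_right, hu, mul_zero]⟩
  refine mem_of_angles_eq (S := S \ {v}) hS.sdiff hT hz hu hzu (hSr v hv)
    (fun s hs => hSr s hs.1) hTr (fun s hs => hzN _ ⟨s, ⟨.inl hs.1, hs.2⟩, rfl⟩)
    (fun s hs hvs => hzN _ ⟨s, ⟨.inr hs, Ne.symm hvs⟩, rfl⟩) ?_
  filter_upwards [hzev] with y hy hyr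
  obtain ⟨hvy, v', hv', hvy'⟩ := hy hyr
  obtain ⟨φ, hφ⟩ := h y hyr
  have hyT : y ∉ convexHull ℝ T := fun hy' => (norm_lt_of_mem_convexHull hTr hy').ne hyr
  -- the isometry takes extreme rays to extreme rays, and those point to elements of `T`
  have tr : ∀ x, SpansExtremeRay (viewCone y (convexHull ℝ S)) x →
      ∃ w ∈ T, ∃ c : ℝ, φ x = c • (w - y) := by
    rintro x ⟨hx, hx0, hx'⟩
    refine SpansExtremeRay.exists_generator hyT ⟨(hφ x).2 hx, by simpa using hx0, ?_⟩
    intro a ha b hb hab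
    obtain ⟨a, rfl⟩ := φ.surjective a
    obtain ⟨b, rfl⟩ := φ.surjective b
    rw [← map_add] at hab
    obtain ⟨c, hc, rfl⟩ := hx' a ((hφ a).1 ha) b ((hφ b).1 hb) (φ.injective hab)
    exact ⟨c, hc, map_smul _ _ _⟩
  obtain ⟨w, hw, c, hc⟩ := tr _ hvy
  obtain ⟨w', hw', c', hc'⟩ := tr _ hvy'
  refine ⟨v', hv', w, hw, w', hw', ?_⟩
  rw [← φ.inner_map_map (v - y) (v - y), ← φ.inner_map_map (v' - y) (v' - y),
    ← φ.inner_map_map (v - y) (v' - y), hc, hc']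
  simp only [real_inner_smul_left, real_inner_smul_right]
  ring

end

/-! ### Polytopes with congruent sight cones -/

lemma AreCongruent.symm {d : ℕ} {A B : Set (EuclideanSpace ℝ (Fin d))} (h : AreCongruent A B) :
    AreCongruent B A := by
  obtain ⟨φ, b, rfl⟩ := h
  refine ⟨φ.symm, -φ.symm b, ?_⟩
  rw [Set.image_image]
  simp

lemma sightCone_eq_image {d : ℕ} (z : EuclideanSpace ℝ (Fin d))
    (K : Set (EuclideanSpace ℝ (Fin d))) : sightCone z K = (fun x => z + x) '' viewCone z K := by
  ext y
  simp only [sightCone, viewCone, Set.mem_iUnion, Set.mem_ofPred_eq, Set.mem_image, exists_prop]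
  constructor
  · rintro ⟨p, hp, s, hs, rfl⟩
    exact ⟨_, ⟨p, hp, s, hs, rfl⟩, rfl⟩
  · rintro ⟨_, ⟨p, hp, s, hs, rfl⟩, rfl⟩
    exact ⟨p, hp, s, hs, rfl⟩

/-- A congruence of pointed sight cones from `z` fixes the apex `z`, so it restricts to a linear
isometry of the cones of directions. -/
lemma AreCongruent.exists_linearIsometry {d : ℕ} {z : EuclideanSpace ℝ (Fin d)}
    {P Q : Set (EuclideanSpace ℝ (Fin d))} (hP : P.Nonempty) (hQ : Q.Nonempty)
    (hpt : ∀ x ∈ viewCone z Q, -x ∈ viewCone z Q → x = 0)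
    (h : AreCongruent (sightCone z P) (sightCone z Q)) :
    ∃ φ : EuclideanSpace ℝ (Fin d) ≃ₗᵢ[ℝ] EuclideanSpace ℝ (Fin d), ∀ x,
      φ x ∈ viewCone z Q ↔ x ∈ viewCone z P := by
  obtain ⟨φ, b, h⟩ := h
  have hmem : ∀ x, φ x + (φ z + b - z) ∈ viewCone z Q ↔ x ∈ viewCone z P := by
    intro x
    have h1 : φ (z + x) + b ∈ sightCone z Q ↔ z + x ∈ sightCone z P := by
      rw [← h]
      exact ((add_left_injective b).comp φ.injective).mem_set_image (f := fun x => φ x + b)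
    rw [sightCone_eq_image, sightCone_eq_image, (add_right_injective z).mem_set_image] at h1
    rw [← h1, ← (add_right_injective z).mem_set_image (f := fun x => z + x)]
    have e : z + (φ x + (φ z + b - z)) = φ (z + x) + b := by rw [map_add]; abel
    rw [e]
  have hzero : ∀ {K : Set (EuclideanSpace ℝ (Fin d))}, K.Nonempty → 0 ∈ viewCone z K :=
    fun ⟨p, hp⟩ => ⟨p, hp, 0, le_rfl, (zero_smul _ _).symm⟩
  -- the displacement `a` of the apex is zero, since both `a` and `-a` lie in the pointed cone
  set a := φ z + b - z with ha
  have ha1 : a ∈ viewCone z Q := by simpa using (hmem 0).2 (hzero hP)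
  have ha2 : φ.symm (-a) ∈ viewCone z P := (hmem _).1 (by simpa using hzero hQ)
  have ha3 : -a ∈ viewCone z Q := by
    have h2 := (hmem _).2 (smul_mem_viewCone zero_le_two ha2)
    have e : φ ((2 : ℝ) • φ.symm (-a)) + a = -a := by
      rw [map_smul, φ.apply_symm_apply]
      module
    rwa [e] at h2
  have ha0 := hpt a ha1 ha3
  exact ⟨φ, fun x => by simpa [ha0] using hmem x⟩

lemma subset_of_congruent_sightCones {d : ℕ} (hd : 2 ≤ d) {r : ℝ}
    {P Q : Set (EuclideanSpace ℝ (Fin d))}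
    (hP : IsConvexPolytope P) (hQ : IsConvexPolytope Q)
    (hPr : P ⊆ Metric.ball 0 r) (hQr : Q ⊆ Metric.ball 0 r)
    (hcong : ∀ z : EuclideanSpace ℝ (Fin d), ‖z‖ = r →
      AreCongruent (sightCone z P) (sightCone z Q)) : P ⊆ Q := by
  have key : ∀ {K : Set (EuclideanSpace ℝ (Fin d))}, IsConvexPolytope K →
      (K.extremePoints ℝ).Finite ∧ convexHull ℝ (K.extremePoints ℝ) = K := by
    rintro K ⟨⟨hconv, hcomp, -⟩, S, hS, rfl⟩
    have hfin := hS.subset (extremePoints_convexHull_subset (𝕜 := ℝ) (A := S))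
    refine ⟨hfin, ?_⟩
    rw [← (hfin.isClosed_convexHull ℝ).closure_eq]
    exact closure_convexHull_extremePoints hcomp hconv
  obtain ⟨hSP, hP'⟩ := key hP
  obtain ⟨hSQ, hQ'⟩ := key hQ
  have hPr' : ∀ s ∈ P, ‖s‖ < r := fun s hs => by simpa using hPr hs
  have hQr' : ∀ s ∈ Q, ‖s‖ < r := fun s hs => by simpa using hQr hs
  have : Nontrivial (EuclideanSpace ℝ (Fin d)) :=
    Module.nontrivial_of_finrank_pos (R := ℝ) (by rw [finrank_euclideanSpace_fin]; omega)
  suffices P.extremePoints ℝ ⊆ Q by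
    rw [← hP']
    exact convexHull_min this hQ.1.1
  intro v hv
  refine extremePoints_subset (mem_of_isometric_viewCones (by simpa using hd) hSP hSQ
    (fun s hs => hPr' s (extremePoints_subset hs)) (fun s hs => hQr' s (extremePoints_subset hs))
    hv ?_ ?_ ?_)
  · intro h
    have h1 := (hP.1.1.mem_extremePoints_iff_mem_sdiff_convexHull_sdiff.1 hv).2
    exact h1 (convexHull_mono (Set.sdiff_subset_sdiff_left extremePoints_subset) h)
  · rw [Set.nonempty_iff_ne_empty, Ne, Set.sdiff_eq_empty]
    intro h
    have h1 : P ⊆ {v} := by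
      rw [← hP', ← convexHull_singleton (𝕜 := ℝ) v]
      exact convexHull_mono h
    obtain ⟨x, hx⟩ := hP.1.2.2
    have := interior_mono h1 hx
    rw [interior_singleton] at this
    exact this
  · intro z hz
    rw [hP', hQ']
    refine (hcong z hz).exists_linearIsometry (hP.1.2.2.mono interior_subset)
      (hQ.1.2.2.mono interior_subset) fun x hx hx' => ?_
    by_contra hx0
    rw [← hQ.1.1.convexHull_eq] at hx hx'
    have hk : ∀ s ∈ Q, 0 < (-innerₛₗ ℝ z) (s - z) := fun s hs => neg_inner_sub_pos hz (hQr' s hs)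
    have h1 := pos_of_mem_viewCone hk hx hx0
    have h2 := pos_of_mem_viewCone hk hx' (neg_ne_zero.2 hx0)
    rw [map_neg] at h2
    linarith

theorem theorem1 (d : ℕ) (hd : 3 ≤ d) (r : ℝ) (hr : 0 < r)
    (P Q : Set (EuclideanSpace ℝ (Fin d)))
    (hP : IsConvexPolytope P) (hQ : IsConvexPolytope Q)
    (hPr : P ⊆ interior (Metric.closedBall (0 : EuclideanSpace ℝ (Fin d)) r))
    (hQr : Q ⊆ interior (Metric.closedBall (0 : EuclideanSpace ℝ (Fin d)) r))
    (hcong : ∀ z ∈ Metric.sphere (0 : EuclideanSpace ℝ (Fin d)) r,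
      AreCongruent (sightCone z P) (sightCone z Q)) :
    P = Q := by
  rw [interior_closedBall _ hr.ne'] at hPr hQr
  have h : ∀ z : EuclideanSpace ℝ (Fin d), ‖z‖ = r →
      AreCongruent (sightCone z P) (sightCone z Q) := fun z hz => hcong z (by simpa using hz)
  exact (subset_of_congruent_sightCones (by omega) hP hQ hPr hQr h).antisymm
    (subset_of_congruent_sightCones (by omega) hQ hP hQr hPr fun z hz => (h z hz).symm)
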